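/- **Proposition (Consistency under minimal node size).** Let $(X_i,Y_i)_{i\ge 1}$ be iid with $X_i\in[0,1]^d$ and $Y_i\in\mathbb{R}$, where $X_1$ has a density $f$ with respect to Lebesgue measure $\lambda$ on $[0,1]^d$ with $f\le C<\infty$, and let $\theta$ be a random parameter independent of the data. For every $n$ let the first $n$ observations be partitioned deterministically into a prediction set $\mathcal{I}=\mathcal{I}_n$ and a growing set $\mathcal{J}=\mathcal{J}_n$ with $n_\mathcal{I}:=|\mathcal{I}|=\Theta(n)$ and $n_\mathcal{J}:=|\mathcal{J}|=\Theta(n)$. For every $n$ let an honest tree be given, that is, a finite binary decision tree on $[0,1]^d$ that is a function of $\theta$ and the data in $\mathcal{J}$ only; each of its splits is made on a single feature $j$ at a threshold $c$ in the $j$-th interval of the node, and a point $z$ goes to the left daughter if $z^j\le c$ and to the right daughter otherwise. Fix $x\in[0,1]^d$, let $L(x,\theta)=\prod_{j=1}^d(a^x_{n,j},b^x_{n,j}]$ be the leaf that $x$ falls into, and let $N_L(x,\theta)=\#\{i\in\mathcal{I}: X_i\in L(x,\theta)\}$. Let $k_n\in\{0,1,2,\dots\}$ be deterministic with $$ n_\mathcal{I}^{4d}\,e^{-k_n^2/(2n_\mathcal{I})}\to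 0\qquad\text{and}\qquad \frac{k_n}{n}\to 0 \qquad (n\to\infty). $$ 1. If $\mathbb{P}(N_L(x,\theta)\ge k_n)\to 1$ (in particular, if $N_L(x,\theta)\ge k_n$ for all $n$), then $n_\mathcal{I}\,\lambda(L(x,\theta))\to\infty$ in probability, that is, $\mathbb{P}(n_\mathcal{I}\lambda(L(x,\theta))\le M)\to 0$ for every $M\in\mathbb{R}$. 2. If almost surely $N_L(x,\theta)\ge k_n$ for all sufficiently large $n$ (in particular, if $N_L(x,\theta)\ge k_n$ for all $n$), and if furthermore $$ \sum_{n_\mathcal{I}=1}^\infty n_\mathcal{I}^{4d}\,e^{-k_n^2/(2n_\mathcal{I})}<\infty, $$ then $n_\mathcal{I}\,\lambda(L(x,\theta))\to\infty$ almost surely. (The series is indexed by the values of $n_\mathcal{I}$; if several $n$ have the same $n_\mathcal{I}$, the largest of the corresponding terms is taken.) -/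

import Mathlib

open MeasureTheory ProbabilityTheory Filter Topology Asymptotics

/-- A finite binary decision tree with axis-parallel splits, rooted at the node with lower corner
`a` and upper corner `b`, that is, at the rectangle `∏ j, (a j, b j]`.  A tree is either a terminal
node, or a split of the node on a feature `j` at a threshold `c` in the `j`-th interval
`(a j, b j]`, together with a tree on the left daughter (`j`-th interval `(a j, c]`) and a tree on
the right daughter (`j`-th interval `(c, b j]`). -/
inductive DecisionTree {d : ℕ} : (Fin d → ℝ) → (Fin d → ℝ) → Type
  | leaf (a b : Fin d → ℝ) : DecisionTree a b
  | split {a b : Fin d → ℝ} (j : Fin d) (c : ℝ) (hc : c ∈ Set.Ioc (a j) (b j))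
      (left : DecisionTree a (Function.update b j c))
      (right : DecisionTree (Function.update a j c) b) : DecisionTree a b

namespace DecisionTree

/-- The pair of corners `(a, b)` of the terminal node reached from the root by the point `x`: at
each split, `x` goes to the left daughter if `x j ≤ c` and to the right daughter otherwise. -/
noncomputable def corners {d : ℕ} {a b : Fin d → ℝ} :
    DecisionTree a b → (Fin d → ℝ) → (Fin d → ℝ) × (Fin d → ℝ)
  | .leaf a b, _ => (a, b)
  | .split j c _ left right, x => if x j ≤ c then left.corners x else right.corners x

/-- The leaf `L(x) = (a₁, b₁] × ⋯ × (a_d, b_d]` of the point `x`. -/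
def leafOf {d : ℕ} {a b : Fin d → ℝ} (T : DecisionTree a b) (x : Fin d → ℝ) :
    Set (Fin d → ℝ) :=
  {z | ∀ j, z j ∈ Set.Ioc ((T.corners x).1 j) ((T.corners x).2 j)}

end DecisionTree

/-- Decision trees on the feature space `[0, 1]^d`. -/
abbrev CubeTree (d : ℕ) : Type := DecisionTree (fun _ : Fin d => (0 : ℝ)) (fun _ => 1)

/-- The law `ν` lives on `[0, 1]^d` and has there a density with respect to Lebesgue measure that
is bounded from above. -/
def HasBoundedDensityOnCube {d : ℕ} (ν : Measure (Fin d → ℝ)) : Prop :=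
  ∃ (f : (Fin d → ℝ) → ℝ) (C : ℝ), Measurable f ∧
    (∀ z ∈ Set.Icc (0 : Fin d → ℝ) 1, 0 ≤ f z ∧ f z ≤ C) ∧
    ν = (volume.restrict (Set.Icc (0 : Fin d → ℝ) 1)).withDensity fun z => ENNReal.ofReal (f z)

/-- For every `n`, the (indices of the) first `n` observations are partitioned deterministically
into a prediction set `I n` and a growing set `J n`, and both have sizes of exact order `n`.
Observations are numbered from `0`. -/
structure IsHonestPartition (I J : ℕ → Finset ℕ) : Prop where
  disjoint : ∀ n, Disjoint (I n) (J n)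
  union_eq : ∀ n, I n ∪ J n = Finset.range n
  card_I : (fun n => ((I n).card : ℝ)) =Θ[atTop] fun n => (n : ℝ)
  card_J : (fun n => ((J n).card : ℝ)) =Θ[atTop] fun n => (n : ℝ)

/-- An honest rule for growing trees: for every `n`, the tree is a function of the growing data
`(X i, Y i)`, `i ∈ J n`, and of the auxiliary parameter only. -/
abbrev HonestRule (d : ℕ) (Θ : Type*) (J : ℕ → Finset ℕ) : Type _ :=
  (n : ℕ) → (J n → (Fin d → ℝ) × ℝ) → Θ → CubeTree d

/-- The leaf `L(x, θ)` of `x` in the tree grown from the growing data among the first `n`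
observations `Z i ω = (X i ω, Y i ω)` and the realisation `θ ω` of the auxiliary parameter. -/
def honestLeaf {Ω Θ : Type*} {d : ℕ} {J : ℕ → Finset ℕ} (grow : HonestRule d Θ J)
    (Z : ℕ → Ω → (Fin d → ℝ) × ℝ) (θ : Ω → Θ) (x : Fin d → ℝ) (n : ℕ) (ω : Ω) :
    Set (Fin d → ℝ) :=
  (grow n (fun i => Z i ω) (θ ω)).leafOf x

open Classical in
/-- The number `N_L(x, θ)` of prediction observations whose features fall into the leaf of `x`. -/
noncomputable def leafCount {Ω Θ : Type*} {d : ℕ} {J : ℕ → Finset ℕ} (grow : HonestRule d Θ J)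
    (I : ℕ → Finset ℕ) (Z : ℕ → Ω → (Fin d → ℝ) × ℝ) (θ : Ω → Θ) (x : Fin d → ℝ)
    (n : ℕ) (ω : Ω) : ℕ :=
  ((I n).filter fun i => (Z i ω).1 ∈ honestLeaf grow Z θ x n ω).card

/-- The quantity `n_I * λ(L(x, θ))`, with `λ` Lebesgue measure. -/
noncomputable def scaledLeafVolume {Ω Θ : Type*} {d : ℕ} {J : ℕ → Finset ℕ}
    (grow : HonestRule d Θ J) (I : ℕ → Finset ℕ) (Z : ℕ → Ω → (Fin d → ℝ) × ℝ) (θ : Ω → Θ)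
    (x : Fin d → ℝ) (n : ℕ) (ω : Ω) : ℝ :=
  ((I n).card : ℝ) * volume.real (honestLeaf grow Z θ x n ω)

/-- Convergence in probability to `+∞`. -/
def TendstoInProbabilityAtTop {Ω : Type*} [MeasurableSpace Ω] (μ : Measure Ω)
    (U : ℕ → Ω → ℝ) : Prop :=
  ∀ M : ℝ, Tendsto (fun n => μ {ω | U n ω ≤ M}) atTop (𝓝 0)

/-- The term `n_I ^ (4 d) * exp (-k_n ^ 2 / (2 n_I))`. -/
noncomputable def growthTerm (d : ℕ) (I : ℕ → Finset ℕ) (k : ℕ → ℕ) (n : ℕ) : ℝ :=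
  ((I n).card : ℝ) ^ (4 * d) * Real.exp (-((k n : ℝ) ^ 2 / (2 * ((I n).card : ℝ))))

/-- The nonnegative series of the terms `u n` converges when it is indexed by the size `m = n_I`
of the prediction set rather than by `n`.  If several `n` share the same `n_I = m`, the largest of
their terms is taken; this does not matter when `u n` is a function of `n_I`, and the condition is
implied by summability over `n`. -/
def SummableOverPredictionSize (I : ℕ → Finset ℕ) (u : ℕ → ℝ) : Prop :=
  (∑' m : ℕ, ⨆ (n : ℕ) (_ : (I n).card = m), ENNReal.ofReal (u n)) < ⊤

/-! ### Leaves are boxes inside the cube -/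

namespace DecisionTree

/-! The leaf is random, but it is always a box in the cube. Rounding its corners outward to the grid
of mesh `1 / n` adds volume at most `2 * d / n`, so leaves of volume `B / n` are covered by at most
`(n + 1) ^ (2 * d)` fixed boxes of mass `O(1 / n)`. A fixed box of this kind holds `k` prediction
points with probability at most `A ^ k / k!`, where `A` does not depend on `n`; a union bound then
covers every possible leaf (`measure_le_leafCount_and_volume_le`). The growth condition forces `k n`
to be at least of order `√n`, so `A ^ k / k!` beats the number of boxes and the bounds are summable
(`exists_summable_bound`). Convergence to zero of the bounds gives the claim in probability,
Borel–Cantelli the almost sure one. -/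

theorem le_corners_fst {d : ℕ} {a b : Fin d → ℝ} (T : DecisionTree a b) (x : Fin d → ℝ) :
    a ≤ (T.corners x).1 := by
  induction T with
  | leaf a b => exact le_rfl
  | split j c hc left right ihl ihr =>
    simp only [corners]
    split_ifs
    · exact ihl
    · exact le_trans (by simpa using hc.1.le) ihr

theorem corners_snd_le {d : ℕ} {a b : Fin d → ℝ} (T : DecisionTree a b) (x : Fin d → ℝ) :
    (T.corners x).2 ≤ b := by
  induction T with
  | leaf a b => exact le_rfl
  | split j c hc left right ihl ihr =>
    simp only [corners]
    split_ifs
    · exact ihl.trans (by simpa using hc.2)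
    · exact ihr

theorem corners_fst_le_snd {d : ℕ} {a b : Fin d → ℝ} (T : DecisionTree a b) (hab : a ≤ b)
    (x : Fin d → ℝ) : (T.corners x).1 ≤ (T.corners x).2 := by
  induction T with
  | leaf a b => exact hab
  | split j c hc left right ihl ihr =>
    simp only [corners]
    split_ifs
    · exact ihl (le_update_iff.2 ⟨hc.1.le, fun i _ => hab i⟩)
    · exact ihr (update_le_iff.2 ⟨hc.2, fun i _ => hab i⟩)

end DecisionTree

theorem setOf_forall_mem_Ioc_eq_pi {d : ℕ} (a b : Fin d → ℝ) :
    {z : Fin d → ℝ | ∀ j, z j ∈ Set.Ioc (a j) (b j)} =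
      Set.univ.pi fun j => Set.Ioc (a j) (b j) := by
  ext z; simp

/-! ### Approximation of boxes by grid boxes -/

/-- A product over factors in `[0, 1]` grows by at most the sum of the growths of the factors. -/
theorem prod_le_prod_add_sum_sub {ι : Type*} (s : Finset ι) (u v : ι → ℝ)
    (hv : ∀ i ∈ s, 0 ≤ v i) (hvu : ∀ i ∈ s, v i ≤ u i) (hu : ∀ i ∈ s, u i ≤ 1) :
    ∏ i ∈ s, u i ≤ ∏ i ∈ s, v i + ∑ i ∈ s, (u i - v i) := by
  classical
  induction s using Finset.induction_on with
  | empty => simp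
  | insert i s hi ih =>
    simp only [Finset.forall_mem_insert] at hv hvu hu
    rw [Finset.prod_insert hi, Finset.prod_insert hi, Finset.sum_insert hi]
    have h0 : 0 ≤ ∏ i ∈ s, v i := Finset.prod_nonneg hv.2
    have h1 : ∏ i ∈ s, v i ≤ 1 :=
      Finset.prod_le_one hv.2 fun i hi => (hvu.2 i hi).trans (hu.2 i hi)
    have hs : 0 ≤ ∑ i ∈ s, (u i - v i) :=
      Finset.sum_nonneg fun i hi => sub_nonneg.2 (hvu.2 i hi)
    -- With `S` the sum over `s`: `u i * ∏ u ≤ u i * (∏ v + S) ≤ v i * ∏ v + (u i - v i) + S`.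
    have h2 := mul_le_mul_of_nonneg_left (ih hv.2 hvu.2 hu.2) (hv.1.trans hvu.1)
    have h3 := mul_le_mul_of_nonneg_right hu.1 hs
    have h4 := mul_le_mul_of_nonneg_left h1 (sub_nonneg.2 hvu.1)
    linarith

/-- The box with corners `l / n` and `u / n` on the grid of mesh `1 / n`. -/
def gridBox {d : ℕ} (n : ℕ) (p : (Fin d → Fin (n + 1)) × (Fin d → Fin (n + 1))) :
    Set (Fin d → ℝ) :=
  Set.univ.pi fun j => Set.Ioc ((p.1 j : ℕ) / n : ℝ) ((p.2 j : ℕ) / n)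

theorem measurableSet_gridBox {d : ℕ} (n : ℕ)
    (p : (Fin d → Fin (n + 1)) × (Fin d → Fin (n + 1))) : MeasurableSet (gridBox n p) :=
  MeasurableSet.univ_pi fun _ => measurableSet_Ioc

/-- A box in the cube is contained in a grid box that is not much larger. -/
theorem exists_gridBox_supset {d n : ℕ} (hn : 0 < n) {a b : Fin d → ℝ} (ha : 0 ≤ a)
    (hab : a ≤ b) (hb : b ≤ 1) :
    ∃ p, {z : Fin d → ℝ | ∀ j, z j ∈ Set.Ioc (a j) (b j)} ⊆ gridBox n p ∧
      volume (gridBox n p) ≤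
        ENNReal.ofReal (volume.real {z : Fin d → ℝ | ∀ j, z j ∈ Set.Ioc (a j) (b j)}
          + 2 * d / n) := by
  have hn' : (0 : ℝ) < n := by exact_mod_cast hn
  -- Lower corners are rounded down and upper corners up, so each side grows by at most `2 / n` and
  -- the indices stay in `0, …, n`.
  have hfl (j) : ⌊(n : ℝ) * a j⌋₊ ≤ n := by
    apply Nat.floor_le_of_le
    exact mul_le_of_le_one_right hn'.le ((hab j).trans (hb j))
  have hce (j) : ⌈(n : ℝ) * b j⌉₊ ≤ n :=
    Nat.ceil_le.2 (mul_le_of_le_one_right hn'.le (hb j))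
  have hl (j) : (⌊(n : ℝ) * a j⌋₊ : ℝ) / n ≤ a j := by
    rw [div_le_iff₀ hn', mul_comm (a j)]
    exact Nat.floor_le (mul_nonneg hn'.le (ha j))
  have hl' (j) : a j - 1 / n ≤ (⌊(n : ℝ) * a j⌋₊ : ℝ) / n := by
    rw [le_div_iff₀ hn', sub_mul, one_div_mul_cancel hn'.ne', mul_comm (a j)]
    exact (Nat.sub_one_lt_floor _).le
  have hu (j) : b j ≤ (⌈(n : ℝ) * b j⌉₊ : ℝ) / n := by
    rw [le_div_iff₀ hn', mul_comm (b j)]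
    exact Nat.le_ceil _
  have hu' (j) : (⌈(n : ℝ) * b j⌉₊ : ℝ) / n ≤ b j + 1 / n := by
    rw [div_le_iff₀ hn', add_mul, one_div_mul_cancel hn'.ne', mul_comm (b j)]
    exact (Nat.ceil_lt_add_one (mul_nonneg hn'.le ((ha j).trans (hab j)))).le
  have hu1 (j) : (⌈(n : ℝ) * b j⌉₊ : ℝ) / n ≤ 1 := by
    rw [div_le_one hn']; exact_mod_cast hce j
  have hl0 (j) : 0 ≤ (⌊(n : ℝ) * a j⌋₊ : ℝ) / n := by positivity
  refine ⟨(fun j => ⟨⌊(n : ℝ) * a j⌋₊, Nat.lt_succ_of_le (hfl j)⟩,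
    fun j => ⟨⌈(n : ℝ) * b j⌉₊, Nat.lt_succ_of_le (hce j)⟩), ?_, ?_⟩
  · rw [setOf_forall_mem_Ioc_eq_pi]
    exact Set.pi_mono fun j _ => Set.Ioc_subset_Ioc (hl j) (hu j)
  · rw [setOf_forall_mem_Ioc_eq_pi, gridBox, Measure.real, Real.volume_pi_Ioc,
      Real.volume_pi_Ioc, ← ENNReal.ofReal_prod_of_nonneg, ← ENNReal.ofReal_prod_of_nonneg,
      ENNReal.toReal_ofReal]
    · apply ENNReal.ofReal_le_ofReal
      refine (prod_le_prod_add_sum_sub _ _ (fun j => b j - a j) ?_ ?_ ?_).trans ?_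
      · exact fun j _ => sub_nonneg.2 (hab j)
      · exact fun j _ => sub_le_sub (hu j) (hl j)
      · exact fun j _ => by linarith [hu1 j, hl0 j]
      · gcongr
        calc _ ≤ ∑ j : Fin d, (2 / n : ℝ) := by
              refine Finset.sum_le_sum fun j _ => ?_
              have : (2 / n : ℝ) = 1 / n + 1 / n := by ring
              rw [this]
              linarith [hl' j, hu' j]
          _ = 2 * d / n := by simp; ring
    · exact Finset.prod_nonneg fun j _ => sub_nonneg.2 (hab j)
    · exact fun j _ => sub_nonneg.2 (hab j)
    · exact fun j _ => sub_nonneg.2 ((hl j).trans ((hab j).trans (hu j)))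

/-! ### Occupation numbers of a fixed set -/

theorem HasBoundedDensityOnCube.exists_le_mul_volume {d : ℕ} {ν : Measure (Fin d → ℝ)}
    (h : HasBoundedDensityOnCube ν) :
    ∃ C : ℝ, 0 ≤ C ∧ ∀ s, MeasurableSet s → ν s ≤ ENNReal.ofReal C * volume s := by
  -- The density is bounded by `C` only on the cube; its value at the origin shows `0 ≤ C`.
  obtain ⟨f, C, -, hf, rfl⟩ := h
  refine ⟨C, (hf 0 (by simp)).1.trans (hf 0 (by simp)).2, fun s hs => ?_⟩
  rw [withDensity_apply _ hs, Measure.restrict_restrict hs]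
  calc _ ≤ ∫⁻ _ in s ∩ Set.Icc (0 : Fin d → ℝ) 1, ENNReal.ofReal C := by
        refine setLIntegral_mono' (hs.inter measurableSet_Icc) fun z hz => ?_
        exact ENNReal.ofReal_le_ofReal (hf z hz.2).2
    _ ≤ _ := by
        rw [setLIntegral_const]
        gcongr
        exact Set.inter_subset_left

open Classical in
/-- Among independent identically distributed variables, at least `k` fall into a given set with
probability at most `(number of variables choose k) * p ^ k`. -/
theorem measure_le_card_filter_mem_le {Ω E : Type*} [MeasurableSpace Ω] [MeasurableSpace E]
    {μ : Measure Ω} {Z : ℕ → Ω → E} (hZ_indep : iIndepFun Z μ)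
    (hZ_ident : ∀ i, IdentDistrib (Z i) (Z 0) μ μ) {s : Set E} (hs : MeasurableSet s)
    (I : Finset ℕ) (k : ℕ) :
    μ {ω | k ≤ (I.filter fun i => Z i ω ∈ s).card} ≤ I.card.choose k * μ (Z 0 ⁻¹' s) ^ k := by
  -- If at least `k` points fall into `s`, some `k`-subset of the indices lies there entirely.
  have hsub : {ω | k ≤ (I.filter fun i => Z i ω ∈ s).card} ⊆
      ⋃ S ∈ I.powersetCard k, ⋂ i ∈ S, Z i ⁻¹' s := by
    intro ω hω
    obtain ⟨S, hS, hSk⟩ := Finset.exists_subset_card_eq hω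
    simp only [Set.mem_iUnion, Set.mem_iInter, Finset.mem_powersetCard]
    exact ⟨S, ⟨hS.trans (Finset.filter_subset _ _), hSk⟩,
      fun i hi => (Finset.mem_filter.1 (hS hi)).2⟩
  calc _ ≤ μ (⋃ S ∈ I.powersetCard k, ⋂ i ∈ S, Z i ⁻¹' s) := measure_mono hsub
    _ ≤ ∑ S ∈ I.powersetCard k, μ (⋂ i ∈ S, Z i ⁻¹' s) := measure_biUnion_finset_le _ _
    _ = ∑ S ∈ I.powersetCard k, μ (Z 0 ⁻¹' s) ^ k := by
        refine Finset.sum_congr rfl fun S hS => ?_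
        rw [hZ_indep.measure_inter_preimage_eq_mul S fun _ _ => hs,
          Finset.prod_congr rfl fun i _ => (hZ_ident i).measure_mem_eq hs, Finset.prod_const,
          (Finset.mem_powersetCard.1 hS).2]
    _ = _ := by rw [Finset.sum_const, Finset.card_powersetCard, nsmul_eq_mul]

/-! ### Large leaves of small volume are unlikely -/

/-- The probability that the leaf of `x` holds at least `k` prediction points although its volume
is at most `B / n`, by a union bound over the grid boxes. -/
theorem measure_le_leafCount_and_volume_le
    {Ω Θ : Type*} [MeasurableSpace Ω] {μ : Measure Ω} {d : ℕ}
    {Z : ℕ → Ω → (Fin d → ℝ) × ℝ} (hZ_meas : ∀ i, Measurable (Z i))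
    (hZ_indep : iIndepFun Z μ) (hZ_ident : ∀ i, IdentDistrib (Z i) (Z 0) μ μ)
    {C : ℝ} (hC : 0 ≤ C) (hνC : ∀ s, MeasurableSet s →
      (μ.map fun ω => (Z 0 ω).1) s ≤ ENNReal.ofReal C * volume s)
    (θ : Ω → Θ) {I J : ℕ → Finset ℕ} (hI : ∀ n, (I n).card ≤ n) (grow : HonestRule d Θ J)
    (x : Fin d → ℝ) {B : ℝ} (hB : 0 ≤ B) {n : ℕ} (hn : 0 < n) (k : ℕ) :
    μ {ω | k ≤ leafCount grow I Z θ x n ω ∧ volume.real (honestLeaf grow Z θ x n ω) ≤ B / n} ≤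
      ENNReal.ofReal ((n + 1 : ℝ) ^ (2 * d) * ((C * (B + 2 * d)) ^ k / k.factorial)) := by
  classical
  have hn' : (0 : ℝ) < n := by exact_mod_cast hn
  set P : Finset ((Fin d → Fin (n + 1)) × (Fin d → Fin (n + 1))) :=
    Finset.univ.filter fun p => volume (gridBox n p) ≤ ENNReal.ofReal ((B + 2 * d) / n) with hP
  set A : (Fin d → Fin (n + 1)) × (Fin d → Fin (n + 1)) → Set Ω := fun p =>
    {ω | k ≤ ((I n).filter fun i => Z i ω ∈ Prod.fst ⁻¹' gridBox n p).card}
  have hsub : {ω | k ≤ leafCount grow I Z θ x n ω ∧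
      volume.real (honestLeaf grow Z θ x n ω) ≤ B / n} ⊆ ⋃ p ∈ P, A p := by
    rintro ω ⟨hk, hvol⟩
    obtain ⟨p, hp, hpv⟩ := exists_gridBox_supset (d := d) hn
      ((grow n (fun i => Z i ω) (θ ω)).le_corners_fst x)
      ((grow n (fun i => Z i ω) (θ ω)).corners_fst_le_snd (fun _ => zero_le_one) x)
      ((grow n (fun i => Z i ω) (θ ω)).corners_snd_le x)
    simp only [Set.mem_iUnion]
    refine ⟨p, ?_, ?_⟩
    · simp only [hP, Finset.mem_filter, Finset.mem_univ, true_and]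
      refine hpv.trans (ENNReal.ofReal_le_ofReal ?_)
      rw [add_div]
      gcongr
      exact hvol
    · refine hk.trans (Finset.card_le_card fun i hi => ?_)
      rw [Finset.mem_filter] at hi ⊢
      exact ⟨hi.1, hp hi.2⟩
  have hA : ∀ p ∈ P, μ (A p) ≤ ENNReal.ofReal ((C * (B + 2 * d)) ^ k / k.factorial) := by
    intro p hp
    have hmass : μ (Z 0 ⁻¹' (Prod.fst ⁻¹' gridBox n p)) ≤
        ENNReal.ofReal (C * ((B + 2 * d) / n)) := by
      have h := hνC _ (measurableSet_gridBox n p)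
      rw [Measure.map_apply (f := fun ω => (Z 0 ω).1) (measurable_fst.comp (hZ_meas 0))
        (measurableSet_gridBox n p)] at h
      rw [ENNReal.ofReal_mul hC]
      exact h.trans (mul_le_mul_right (Finset.mem_filter.1 hp).2 _)
    refine (measure_le_card_filter_mem_le hZ_indep hZ_ident
      (measurable_fst (measurableSet_gridBox n p)) (I n) k).trans ?_
    calc _ ≤ ((I n).card.choose k : ENNReal) * ENNReal.ofReal (C * ((B + 2 * d) / n)) ^ k := by
          gcongr
      _ = ENNReal.ofReal (((I n).card.choose k : ℝ) * (C * ((B + 2 * d) / n)) ^ k) := by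
          rw [ENNReal.ofReal_mul (Nat.cast_nonneg _), ENNReal.ofReal_natCast,
            ENNReal.ofReal_pow (by positivity)]
      _ ≤ _ := by
          apply ENNReal.ofReal_le_ofReal
          -- The factor `n ^ k` cancels the `n ^ (-k)` coming from the mass of the box.
          have h1 : ((I n).card.choose k : ℝ) ≤ (n : ℝ) ^ k / k.factorial :=
            (Nat.choose_le_pow_div k (I n).card).trans (by gcongr; exact hI n)
          calc _ ≤ (n : ℝ) ^ k / k.factorial * (C * ((B + 2 * d) / n)) ^ k := by gcongr
            _ = _ := by
              rw [div_mul_eq_mul_div, ← mul_pow]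
              congr 2
              field_simp
  calc _ ≤ μ (⋃ p ∈ P, A p) := measure_mono hsub
    _ ≤ ∑ p ∈ P, μ (A p) := measure_biUnion_finset_le _ _
    _ ≤ P.card • ENNReal.ofReal ((C * (B + 2 * d)) ^ k / k.factorial) :=
        Finset.sum_le_card_nsmul _ _ _ hA
    _ ≤ _ := by
        rw [nsmul_eq_mul, ENNReal.ofReal_mul (by positivity)]
        gcongr
        rw [← ENNReal.ofReal_natCast]
        apply ENNReal.ofReal_le_ofReal
        have : P.card ≤ (n + 1) ^ (2 * d) := by
          refine (Finset.card_le_univ _).trans (le_of_eq ?_)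
          simp [two_mul, pow_add]
        exact_mod_cast this

/-! ### Consequences of the growth of the minimal node size -/

theorem IsHonestPartition.card_le {I J : ℕ → Finset ℕ} (h : IsHonestPartition I J) (n : ℕ) :
    (I n).card ≤ n := by
  calc (I n).card ≤ (Finset.range n).card :=
        Finset.card_le_card (h.union_eq n ▸ Finset.subset_union_left)
    _ = n := Finset.card_range n

theorem IsHonestPartition.exists_mul_le_card {I J : ℕ → Finset ℕ} (h : IsHonestPartition I J) :
    ∃ c : ℝ, 0 < c ∧ ∀ᶠ n : ℕ in atTop, c * n ≤ (I n).card := by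
  obtain ⟨c, hc, hcI⟩ := h.card_I.2.exists_pos
  refine ⟨c⁻¹, inv_pos.2 hc, hcI.bound.mono fun n hn => ?_⟩
  rw [inv_mul_le_iff₀ hc]
  simpa using hn

/-- The polynomial factor is at least `1`, so once the growth term is below `exp (-1)` the exponent
alone gives `k n ^ 2 > 2 * n_I`. -/
theorem eventually_card_le_sq_of_growthTerm {d : ℕ} {I : ℕ → Finset ℕ} {k : ℕ → ℕ}
    (hI : ∀ᶠ n in atTop, 0 < (I n).card) (hk : Tendsto (growthTerm d I k) atTop (𝓝 0)) :
    ∀ᶠ n in atTop, ((I n).card : ℝ) ≤ (k n : ℝ) ^ 2 := by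
  filter_upwards [hI, hk.eventually_lt_const (Real.exp_pos (-1))] with n hn hlt
  have hn1 : (1 : ℝ) ≤ (I n).card := by exact_mod_cast hn
  have h1 : Real.exp (-((k n : ℝ) ^ 2 / (2 * ((I n).card : ℝ)))) < Real.exp (-1) :=
    (le_mul_of_one_le_left (Real.exp_pos _).le (one_le_pow₀ hn1)).trans_lt hlt
  rw [Real.exp_lt_exp, neg_lt_neg_iff, one_lt_div (by positivity)] at h1
  linarith

/-- Since `k ^ r ≤ r! * e ^ k`, the power of `k` only replaces `A` by `e * A`, and one term of the
exponential series is at most its sum. -/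
theorem pow_mul_pow_div_factorial_le {A : ℝ} (hA : 0 ≤ A) (r k : ℕ) :
    (k : ℝ) ^ r * (A ^ k / k.factorial) ≤ r.factorial * Real.exp (Real.exp 1 * A) := by
  have h1 : (k : ℝ) ^ r ≤ r.factorial * Real.exp 1 ^ k := by
    have := Real.pow_div_factorial_le_exp (k : ℝ) (by positivity) r
    rwa [div_le_iff₀ (by positivity), mul_comm, ← mul_one (k : ℝ), Real.exp_nat_mul, mul_one] at this
  calc _ ≤ (r.factorial * Real.exp 1 ^ k) * (A ^ k / k.factorial) := by gcongr
    _ = r.factorial * ((Real.exp 1 * A) ^ k / k.factorial) := by rw [mul_pow]; ring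
    _ ≤ _ := by
      gcongr
      exact Real.pow_div_factorial_le_exp _ (by positivity) k

/-- If `k n` is at least of order `√n`, then `A ^ k / k!` beats every polynomial. -/
theorem summable_pow_mul_pow_div_factorial {k : ℕ → ℕ} {c A : ℝ} (hc : 0 < c) (hA : 0 ≤ A)
    (hk : ∀ᶠ n : ℕ in atTop, c * n ≤ (k n : ℝ) ^ 2) (s : ℕ) :
    Summable fun n : ℕ => (n + 1 : ℝ) ^ s * (A ^ k n / (k n).factorial) := by
  -- `k ^ (2 * (s + 2))` dominates `(c * n) ^ (s + 2)`: `s` powers absorb the polynomial and two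
  -- leave a summable `1 / n ^ 2`.
  set D : ℝ := (2 * (s + 2)).factorial * Real.exp (Real.exp 1 * A)
  refine Summable.of_norm_bounded_eventually_nat
    (g := fun n : ℕ => 2 ^ s * (D / c ^ (s + 2)) * (1 / (n : ℝ) ^ 2))
    ((Real.summable_one_div_nat_pow.2 one_lt_two).mul_left _) ?_
  filter_upwards [hk, eventually_gt_atTop 0] with n hkn hn
  have hn' : (1 : ℝ) ≤ n := by exact_mod_cast hn
  have hT : 0 ≤ A ^ k n / ((k n).factorial : ℝ) := by positivity
  have h1 : (c * n) ^ (s + 2) * (A ^ k n / (k n).factorial) ≤ D := by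
    refine le_trans ?_ (pow_mul_pow_div_factorial_le hA (2 * (s + 2)) (k n))
    rw [pow_mul]
    gcongr
  rw [Real.norm_of_nonneg (by positivity)]
  calc _ ≤ (2 * n : ℝ) ^ s * (A ^ k n / (k n).factorial) := by gcongr; linarith
    _ = 2 ^ s * ((c * n) ^ (s + 2) * (A ^ k n / (k n).factorial) / c ^ (s + 2)) *
          (1 / (n : ℝ) ^ 2) := by rw [mul_pow c, mul_pow, pow_add (n : ℝ)]; field_simp
    _ ≤ _ := by gcongr

/-- For a fixed bound `M`, the probabilities of `k n` points in a leaf with scaled volume at most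
`M` are summable. -/
theorem exists_summable_bound
    {Ω Θ : Type*} [MeasurableSpace Ω] {μ : Measure Ω} {d : ℕ}
    {Z : ℕ → Ω → (Fin d → ℝ) × ℝ} (hZ_meas : ∀ i, Measurable (Z i))
    (hZ_indep : iIndepFun Z μ) (hZ_ident : ∀ i, IdentDistrib (Z i) (Z 0) μ μ)
    (hX : HasBoundedDensityOnCube (μ.map fun ω => (Z 0 ω).1))
    (θ : Ω → Θ) {I J : ℕ → Finset ℕ} (hIJ : IsHonestPartition I J) (grow : HonestRule d Θ J)
    (x : Fin d → ℝ) {k : ℕ → ℕ} (hk_growth : Tendsto (growthTerm d I k) atTop (𝓝 0)) (M : ℝ) :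
    ∃ g : ℕ → ℝ, Summable g ∧ ∀ᶠ n in atTop,
      μ {ω | k n ≤ leafCount grow I Z θ x n ω ∧ scaledLeafVolume grow I Z θ x n ω ≤ M} ≤
        ENNReal.ofReal (g n) := by
  obtain ⟨C, hC, hνC⟩ := hX.exists_le_mul_volume
  obtain ⟨c, hc, hcI⟩ := hIJ.exists_mul_le_card
  have hpos : ∀ᶠ n in atTop, 0 < (I n).card := by
    filter_upwards [hcI, eventually_gt_atTop 0] with n hn hn0
    have : (0 : ℝ) < n := by exact_mod_cast hn0
    exact_mod_cast (mul_pos hc this).trans_le hn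
  have hk : ∀ᶠ n : ℕ in atTop, c * n ≤ (k n : ℝ) ^ 2 := by
    filter_upwards [hcI, eventually_card_le_sq_of_growthTerm hpos hk_growth] with n h1 h2
    exact h1.trans h2
  -- As `c * n ≤ n_I`, scaled volume at most `M` means volume at most `(max M 0 / c) / n`; the
  -- maximum keeps the constant nonnegative.
  have hB : 0 ≤ max M 0 / c := by positivity
  refine ⟨_, summable_pow_mul_pow_div_factorial hc
    (A := C * (max M 0 / c + 2 * d)) (by positivity) hk (2 * d), ?_⟩
  filter_upwards [hcI, eventually_gt_atTop 0] with n hcn hn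
  refine le_trans (measure_mono ?_) (measure_le_leafCount_and_volume_le hZ_meas hZ_indep hZ_ident
    hC hνC θ hIJ.card_le grow x hB hn (k n))
  rintro ω ⟨h1, h2⟩
  refine ⟨h1, ?_⟩
  have hn' : (0 : ℝ) < n := by exact_mod_cast hn
  rw [div_div, le_div_iff₀ (by positivity), mul_comm]
  exact (mul_le_mul_of_nonneg_right hcn measureReal_nonneg).trans (h2.trans (le_max_left _ _))

/-! ### Convergence in probability and almost surely -/

theorem mainTheorem5
    {Ω Θ : Type*} [MeasurableSpace Ω] [MeasurableSpace Θ]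
    (μ : Measure Ω) [IsProbabilityMeasure μ]
    (d : ℕ)
    -- iid data `Z i = (X i, Y i)`, with the law of the features having a bounded density
    (Z : ℕ → Ω → (Fin d → ℝ) × ℝ) (hZ_meas : ∀ i, Measurable (Z i))
    (hZ_indep : iIndepFun Z μ) (hZ_ident : ∀ i, IdentDistrib (Z i) (Z 0) μ μ)
    (hX : HasBoundedDensityOnCube (μ.map fun ω => (Z 0 ω).1))
    -- auxiliary parameter, independent of the data
    (θ : Ω → Θ) (hθ_meas : Measurable θ) (hθ_indep : IndepFun θ (fun ω i => Z i ω) μ)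
    -- honest tree
    (I J : ℕ → Finset ℕ) (hIJ : IsHonestPartition I J) (grow : HonestRule d Θ J)
    -- prediction point and minimal node size
    (x : Fin d → ℝ) (hx : x ∈ Set.Icc (0 : Fin d → ℝ) 1)
    (k : ℕ → ℕ)
    (hk_growth : Tendsto (growthTerm d I k) atTop (𝓝 0))
    (hk_small : Tendsto (fun n => (k n : ℝ) / n) atTop (𝓝 0)) :
    (Tendsto (fun n => μ {ω | ¬ k n ≤ leafCount grow I Z θ x n ω}) atTop (𝓝 0) →
      TendstoInProbabilityAtTop μ (scaledLeafVolume grow I Z θ x)) ∧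
    ((∀ᵐ ω ∂μ, ∀ᶠ n in atTop, k n ≤ leafCount grow I Z θ x n ω) →
      SummableOverPredictionSize I (growthTerm d I k) →
        ∀ᵐ ω ∂μ, Tendsto (fun n => scaledLeafVolume grow I Z θ x n ω) atTop atTop) := by
  have key := exists_summable_bound hZ_meas hZ_indep hZ_ident hX θ hIJ grow x hk_growth
  refine ⟨fun hcount M => ?_, fun hcount _ => ?_⟩
  · obtain ⟨g, hg, hgμ⟩ := key M
    have hg0 : Tendsto (fun n => ENNReal.ofReal (g n)) atTop (𝓝 0) := by
      simpa using ENNReal.tendsto_ofReal hg.tendsto_atTop_zero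
    have hsum := hcount.add hg0
    rw [add_zero] at hsum
    refine tendsto_of_tendsto_of_tendsto_of_le_of_le' tendsto_const_nhds hsum
      (Eventually.of_forall fun _ => zero_le) ?_
    filter_upwards [hgμ] with n hn
    -- Either the leaf has fewer than `k n` points, or it is a small leaf with many points.
    refine le_trans (measure_mono ?_) ((measure_union_le _ _).trans (add_le_add_right hn _))
    intro ω hω
    by_cases h : k n ≤ leafCount grow I Z θ x n ω
    · exact Or.inr ⟨h, hω⟩
    · exact Or.inl h
  · have hae : ∀ M : ℕ, ∀ᵐ ω ∂μ, ∀ᶠ n in atTop,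
        ¬ (k n ≤ leafCount grow I Z θ x n ω ∧ scaledLeafVolume grow I Z θ x n ω ≤ M) := by
      intro M
      obtain ⟨g, hg, hgμ⟩ := key M
      -- The bound holds only from some `N` on, so Borel–Cantelli is applied to the shifted
      -- sequence.
      obtain ⟨N, hN⟩ := eventually_atTop.1 hgμ
      have hfin : ∑' n, μ {ω | k (n + N) ≤ leafCount grow I Z θ x (n + N) ω ∧
          scaledLeafVolume grow I Z θ x (n + N) ω ≤ M} ≠ ⊤ :=
        ne_top_of_le_ne_top (((summable_nat_add_iff N).2 hg).tsum_ofReal_ne_top)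
          (ENNReal.tsum_le_tsum fun n => hN _ (Nat.le_add_left _ _))
      filter_upwards [ae_eventually_notMem hfin] with ω hω
      rwa [← map_add_atTop_eq_nat N, eventually_map]
    filter_upwards [hcount, ae_all_iff.2 hae] with ω h1 h2
    refine tendsto_atTop.2 fun b => ?_
    obtain ⟨M, hM⟩ := exists_nat_ge b
    filter_upwards [h1, h2 M] with n hn1 hn2
    exact hM.trans (le_of_not_ge fun h => hn2 ⟨hn1, h⟩)
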